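/- Fix integers $K,d\ge 1$, real constants $\alpha,\beta>0$, and a group $\mathcal G\in\{\mathcal O(d),\mathcal{SO}(d)\}$, where $d\ge 2$ if $\mathcal G=\mathcal{SO}(d)$. For $n$ divisible by $K$ put $m=n/K$, $p=\frac{\alpha\log n}{n}$, $q=\frac{\beta\log n}{n}$. Let $C^*:[n]\to[K]$ be a map all of whose fibres have size $m$, let $R_1^*,\dots,R_n^*\in\mathcal G$, and let $V^*\in\mathbb R^{nd\times Kd}$ be the matrix whose $(i,k)$-th $d\times d$ block is $R_i^*$ if $C^*(i)=k$ and $0$ otherwise. Let $A\in\mathbb R^{nd\times nd}$ be the random symmetric matrix of the stochastic group block model: its diagonal $d\times d$ blocks are $I_d$; for $i<j$, $A_{ij}=w_{ij}R_i^*R_j^{*\top}$ if $C^*(i)=C^*(j)$ and $A_{ij}=u_{ij}R_{ij}$ if $C^*(i)\ne C^*(j)$, with all $w_{ij}\sim\mathrm{Bern}(p)$, $u_{ij}\sim\mathrm{Bern}(q)$, $R_{ij}\sim\mathrm{Unif}(\mathcal G)$ (Haar measure) independent; and $A_{ji}=A_{ij}^\top$. For $X\in\mathbb R^{nd\times Kd}$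 let $\mu(X)\in\mathbb R^{n\times K}$ be the matrix of the nuclear norms of the $d\times d$ blocks of $X$. Suppose that $$\sqrt{2K\beta}<\alpha\qquad\text{and}\qquad \alpha-\sqrt{2K\beta}\,\log\frac{e\alpha}{\sqrt{2K\beta}}>K .$$ Then there are constants $\chi>0$, $c>0$ and $N$, depending only on $\alpha,\beta,K,d,\mathcal G$, such that for all $n\ge N$ divisible by $K$ and all $C^*$, $R_1^*,\dots,R_n^*$ as above, the following two conditions hold simultaneously with probability at least $1-n^{-c}$: (i) $\mu(AV^*)_{iC^*(i)}-\mu(AV^*)_{ij}\ge\chi mp>0$ for all $i\in[n]$ and all $j\in[K]$ with $j\neq C^*(i)$; (ii) $\mu(AV^*)_{iC^*(i)}\ge\frac{\sqrt{2K\beta}}{\alpha}\,mp$ for all $i\in[n]$. Moreover, for every $K\ge 1$ this parameter region goes below the information-theoretic threshold $\sqrt\alpha-\sqrt\beta>\sqrt K$ of the stochastic block model: there are $\alpha,\beta>0$ that satisfy the two displayed inequalities and $\sqrt\alpha-\sqrt\beta<\sqrt K$. -/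

import Mathlib

open MeasureTheory ProbabilityTheory

noncomputable section

/-- The two kinds of groups that are synchronized: `O(d)` and `SO(d)`. -/
inductive SyncGroup where
  | orthogonal
  | special

/-- The group itself, as a subgroup of Mathlib's `Matrix.orthogonalGroup`: either all of `O(d)`,
or `SO(d)`, the kernel of the determinant on `O(d)`. -/
def SyncGroup.grp (G : SyncGroup) (d : ℕ) : Subgroup (Matrix.orthogonalGroup (Fin d) ℝ) :=
  match G with
  | .orthogonal => ⊤
  | .special => (Matrix.detMonoidHom.comp (Matrix.orthogonalGroup (Fin d) ℝ).subtype).ker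

/-- The `d × d` real matrix underlying a group element. -/
def SyncGroup.mat {G : SyncGroup} {d : ℕ} (g : G.grp d) : Matrix (Fin d) (Fin d) ℝ :=
  ((g : Matrix.orthogonalGroup (Fin d) ℝ) : Matrix (Fin d) (Fin d) ℝ)

instance SyncGroup.instMeasurableSpace (G : SyncGroup) (d : ℕ) : MeasurableSpace (G.grp d) :=
  borel _

instance SyncGroup.instBorelSpace (G : SyncGroup) (d : ℕ) : BorelSpace (G.grp d) := ⟨rfl⟩

theorem isCompact_orthogonalGroup (d : ℕ) :
    IsCompact (Matrix.orthogonalGroup (Fin d) ℝ : Set (Matrix (Fin d) (Fin d) ℝ)) := by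
  have hK : IsCompact (Set.pi Set.univ fun _ : Fin d => Set.pi Set.univ fun _ : Fin d =>
      Set.Icc (-1 : ℝ) 1) :=
    isCompact_univ_pi fun _ => isCompact_univ_pi fun _ => isCompact_Icc
  have hc : IsClosed
      (Matrix.orthogonalGroup (Fin d) ℝ : Set (Matrix (Fin d) (Fin d) ℝ)) := by
    have : (Matrix.orthogonalGroup (Fin d) ℝ : Set (Matrix (Fin d) (Fin d) ℝ)) =
        {A | A * A.transpose = 1} := by
      ext A
      exact Matrix.mem_orthogonalGroup_iff _ _
    rw [this]
    exact isClosed_eq (by fun_prop) continuous_const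
  refine IsCompact.of_isClosed_subset hK hc ?_
  intro A hA i _ j _
  have h := entry_norm_bound_of_unitary (𝕜 := ℝ) hA i j
  exact abs_le.mp h

instance (d : ℕ) : CompactSpace (Matrix.orthogonalGroup (Fin d) ℝ) :=
  isCompact_iff_compactSpace.mp (isCompact_orthogonalGroup d)

instance SyncGroup.instCompactSpace (G : SyncGroup) (d : ℕ) : CompactSpace (G.grp d) := by
  refine isCompact_iff_compactSpace.mp (IsClosed.isCompact ?_)
  cases G with
  | orthogonal => exact isClosed_univ
  | special =>
    change IsClosed {g : Matrix.orthogonalGroup (Fin d) ℝ |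
      (g : Matrix (Fin d) (Fin d) ℝ).det = 1}
    exact isClosed_eq (Continuous.matrix_det continuous_subtype_val) continuous_const

/-- `Unif(G)`: the Haar measure of total mass one. -/
def SyncGroup.unif (G : SyncGroup) (d : ℕ) : Measure (G.grp d) :=
  Measure.haarMeasure (⊤ : TopologicalSpace.PositiveCompacts (G.grp d))

/-- `C : [n] → [K]` is a (balanced) clustering function: every cluster has size `n / K`. -/
def IsClustering {n K : ℕ} (C : Fin n → Fin K) : Prop :=
  ∀ k, K * (Finset.univ.filter fun i => C i = k).card = n

/-- The `(i, j)` block of size `d × d` of a block matrix. -/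
def blk {n m d : ℕ} (X : Matrix (Fin n × Fin d) (Fin m × Fin d) ℝ) (i : Fin n) (j : Fin m) :
    Matrix (Fin d) (Fin d) ℝ :=
  Matrix.of fun a b => X (i, a) (j, b)

/-- The matrix `(1_{1×K} ⊗ R) ⊙ (H ⊗ 1_{d×d})`, where `H` is the clustering matrix of `C`: its
`(i, k)` block is `R i` if `C i = k`, and `0` otherwise. -/
def groundTruth {n K d : ℕ} {G : SyncGroup} (C : Fin n → Fin K) (R : Fin n → G.grp d) :
    Matrix (Fin n × Fin d) (Fin K × Fin d) ℝ :=
  Matrix.of fun x y => if C x.1 = y.1 then SyncGroup.mat (R x.1) x.2 y.2 else 0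

/-- The nuclear norm of a square matrix: the sum of its singular values. -/
def nuclearNorm {d : ℕ} (X : Matrix (Fin d) (Fin d) ℝ) : ℝ :=
  ∑ k ∈ Finset.range d, (Matrix.toEuclideanLin X).singularValues k

/-- `μ(X)`: the matrix of the nuclear norms of the blocks of `X`. -/
def blockNuclear {n K d : ℕ} (X : Matrix (Fin n × Fin d) (Fin K × Fin d) ℝ) :
    Matrix (Fin n) (Fin K) ℝ :=
  Matrix.of fun i j => nuclearNorm (blk X i j)

/-- Sample space of the stochastic group block model on `n` nodes: an edge indicator and a group
element for each pair of nodes. Only the coordinates `(i, j)` with `i < j` are used. -/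
abbrev SGBMSpace (n d : ℕ) (G : SyncGroup) : Type :=
  (Fin n × Fin n → Bool) × (Fin n × Fin n → G.grp d)

/-- All coordinates are independent; the edge indicator of `(i, j)` is Bernoulli with parameter `p`
if `i`, `j` are in the same cluster and `q` otherwise; the group elements are uniform. -/
def sgbmMeasure {n K : ℕ} (C : Fin n → Fin K) (p q : unitInterval) (d : ℕ) (G : SyncGroup) :
    Measure (SGBMSpace n d G) :=
  (Measure.pi fun e : Fin n × Fin n =>
      bernoulliMeasure true false (if C e.1 = C e.2 then p else q)).prod
    (Measure.pi fun _ : Fin n × Fin n => G.unif d)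

/-- The `(i, j)` block of the observation matrix for `i < j`. -/
def obsUpper {n K d : ℕ} {G : SyncGroup} (C : Fin n → Fin K) (R : Fin n → G.grp d)
    (ω : SGBMSpace n d G) (i j : Fin n) : Matrix (Fin d) (Fin d) ℝ :=
  if ω.1 (i, j) = true then
    if C i = C j then SyncGroup.mat (R i) * (SyncGroup.mat (R j)).transpose
    else SyncGroup.mat (ω.2 (i, j))
  else 0

/-- The observation matrix `A` of the stochastic group block model. -/
def observation {n K d : ℕ} {G : SyncGroup} (C : Fin n → Fin K) (R : Fin n → G.grp d)
    (ω : SGBMSpace n d G) : Matrix (Fin n × Fin d) (Fin n × Fin d) ℝ :=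
  Matrix.of fun x y =>
    (if x.1 < y.1 then obsUpper C R ω x.1 y.1
      else if y.1 < x.1 then (obsUpper C R ω y.1 x.1).transpose
      else 1) x.2 y.2

/-- The observation matrix `A` preserves `V` (with clustering function `C`) by `δ`-separation. -/
def PreservesBySeparation {n K d : ℕ} (A : Matrix (Fin n × Fin d) (Fin n × Fin d) ℝ)
    (C : Fin n → Fin K) (V : Matrix (Fin n × Fin d) (Fin K × Fin d) ℝ) (δ : ℝ) : Prop :=
  0 < δ ∧ ∀ i j, j ≠ C i → δ ≤ blockNuclear (A * V) i (C i) - blockNuclear (A * V) i j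

/-- The region `√(2Kβ) < α`, `α - √(2Kβ) log (eα / √(2Kβ)) > K` of the parameters. -/
def InRegion (K : ℕ) (α β : ℝ) : Prop :=
  Real.sqrt (2 * K * β) < α ∧
    (K : ℝ) < α - Real.sqrt (2 * K * β) *
      Real.log (Real.exp 1 * α / Real.sqrt (2 * K * β))

end

/-!
A node `i` fails separation from cluster `k` only if the nuclear norm of the `(i, k)` block of `A V`
nearly reaches that of its own block, which is `d` times the degree `W` of `i` inside its cluster.
Nuclear norm is the maximum of `trace (Oᵀ X)` over orthogonal `O`, so an `ε`-net of `O(d)` reduces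
this to finitely many events about `T - (1 - ε) W`, with `T` a normalized trace independent of `W`.

The Haar measure has mean zero, hence a summand of `T` has moment generating function at most
`cosh l` rather than `exp l`. With `a = α / K`, `b = β / K` and `ε → 0` the Chernoff exponent is
`b (cosh l - 1) + a (exp (-l) - 1)`, in units of `log n`; minimized over `l` it equals
`-(√(a + b / 2) - √(b / 2))²`, which is below `-1` exactly when `1 + √(2 b) < a`, that is
`K + √(2 K β) < α`. The second inequality of the region reads
`K < α - s - s log (α / s)` with `s = √(2 K β)`: it implies the former, and it is the condition
under which the lower tail of `W` at `s / α` times its mean is `o(1 / n)`. A union bound over nodes,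
clusters and the net concludes.
-/

section NuclearNorm

open scoped Matrix

theorem inner_map_eigenvectorBasis_adjoint_comp_self {𝕜 E F : Type*} [RCLike 𝕜]
    [NormedAddCommGroup E] [InnerProductSpace 𝕜 E] [FiniteDimensional 𝕜 E]
    [NormedAddCommGroup F] [InnerProductSpace 𝕜 F] [FiniteDimensional 𝕜 F]
    (T : E →ₗ[𝕜] F) {m : ℕ} (hE : Module.finrank 𝕜 E = m) (k l : Fin m) :
    inner 𝕜 (T (T.isSymmetric_adjoint_comp_self.eigenvectorBasis hE k))
        (T (T.isSymmetric_adjoint_comp_self.eigenvectorBasis hE l)) =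
      if k = l then (T.singularValues l : 𝕜) ^ 2 else 0 := by
  set v := T.isSymmetric_adjoint_comp_self.eigenvectorBasis hE
  have hv : T.adjoint (T (v l)) = (T.singularValues l : 𝕜) ^ 2 • v l := by
    rw [← RCLike.ofReal_pow, T.sq_singularValues_fin hE l]
    exact T.isSymmetric_adjoint_comp_self.apply_eigenvectorBasis hE l
  rw [← LinearMap.adjoint_inner_right, hv, inner_smul_right,
    orthonormal_iff_ite.mp v.orthonormal, mul_ite, mul_one, mul_zero]

theorem exists_orthonormalBasis_map_eq_singularValues_smul {𝕜 E F : Type*} [RCLike 𝕜]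
    [NormedAddCommGroup E] [InnerProductSpace 𝕜 E] [FiniteDimensional 𝕜 E]
    [NormedAddCommGroup F] [InnerProductSpace 𝕜 F] [FiniteDimensional 𝕜 F]
    (T : E →ₗ[𝕜] F) {m : ℕ} (hE : Module.finrank 𝕜 E = m) (hF : Module.finrank 𝕜 F = m) :
    ∃ (v : OrthonormalBasis (Fin m) 𝕜 E) (u : OrthonormalBasis (Fin m) 𝕜 F),
      ∀ k, T (v k) = (T.singularValues k : 𝕜) • u k := by
  set v := T.isSymmetric_adjoint_comp_self.eigenvectorBasis hE
  have hinner (k l : Fin m) : inner 𝕜 (T (v k)) (T (v l)) =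
      if k = l then (T.singularValues l : 𝕜) ^ 2 else 0 :=
    inner_map_eigenvectorBasis_adjoint_comp_self T hE k l
  let support : Set (Fin m) := {k | T.singularValues k ≠ 0}
  have horth : Orthonormal 𝕜
      (support.domRestrict fun k => (T.singularValues k : 𝕜)⁻¹ • T (v k)) := by
    rw [orthonormal_iff_ite]
    rintro ⟨k, hk⟩ ⟨l, _⟩
    simp only [Set.domRestrict_apply, inner_smul_left, inner_smul_right, hinner, Subtype.mk.injEq]
    split_ifs with h
    · subst h
      have hk' : (T.singularValues k : 𝕜) ≠ 0 := RCLike.ofReal_ne_zero.mpr hk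
      simp only [map_inv₀, RCLike.conj_ofReal]
      field_simp
    · simp only [mul_zero]
  obtain ⟨u, hu⟩ := horth.exists_orthonormalBasis_extension_of_card_eq (by simp [hF])
  refine ⟨v, u, fun k => ?_⟩
  by_cases hk : T.singularValues k = 0
  · have hTv : T (v k) = 0 := by
      rw [← inner_self_eq_zero (𝕜 := 𝕜), hinner, if_pos rfl, hk]
      simp
    rw [hTv, hk, RCLike.ofReal_zero, zero_smul]
  · rw [hu k hk, smul_smul, mul_inv_cancel₀ (RCLike.ofReal_ne_zero.mpr hk), one_smul]

theorem trace_transpose_mul_eq_sum_inner {m n ι : Type*} [Fintype m] [Fintype n]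
    [DecidableEq n] [Fintype ι] (A B : Matrix m n ℝ)
    (v : OrthonormalBasis ι ℝ (EuclideanSpace ℝ n)) :
    (Aᵀ * B).trace =
      ∑ k, inner ℝ (Matrix.toEuclideanLin A (v k)) (Matrix.toEuclideanLin B (v k)) := by
  classical
  have htrace : (Aᵀ * B).trace = LinearMap.trace ℝ _ (Matrix.toEuclideanLin (Aᵀ * B)) := by
    rw [Matrix.toEuclideanLin_eq_toLin_orthonormal, Matrix.trace_toLin_eq]
  have hcomp : Matrix.toEuclideanLin (Aᵀ * B) =
      (Matrix.toEuclideanLin A).adjoint ∘ₗ Matrix.toEuclideanLin B := by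
    rw [← Matrix.toEuclideanLin_conjTranspose_eq_adjoint,
      Matrix.conjTranspose_eq_transpose_of_trivial]
    exact Matrix.toLpLin_mul _ _ _ _ _
  rw [htrace, LinearMap.trace_eq_sum_inner _ v, hcomp]
  refine Finset.sum_congr rfl fun k _ => ?_
  rw [LinearMap.comp_apply, LinearMap.adjoint_inner_right]

theorem norm_toEuclideanLin_of_mem_unitaryGroup {𝕜 n : Type*} [RCLike 𝕜] [Fintype n]
    [DecidableEq n] {U : Matrix n n 𝕜} (hU : U ∈ Matrix.unitaryGroup n 𝕜)
    (x : EuclideanSpace 𝕜 n) : ‖Matrix.toEuclideanLin U x‖ = ‖x‖ :=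
  ContinuousLinearMap.norm_map_of_mem_unitary
    (Unitary.map_mem (Matrix.toEuclideanCLM (n := n) (𝕜 := 𝕜)) hU) x

theorem exists_mem_unitaryGroup_toEuclideanLin_eq {𝕜 n : Type*} [RCLike 𝕜] [Fintype n]
    [DecidableEq n] (e : EuclideanSpace 𝕜 n ≃ₗᵢ[𝕜] EuclideanSpace 𝕜 n) :
    ∃ U ∈ Matrix.unitaryGroup n 𝕜, ∀ x, Matrix.toEuclideanLin U x = e x := by
  let U := (Matrix.toEuclideanCLM (n := n) (𝕜 := 𝕜)).symm (Unitary.linearIsometryEquiv.symm e)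
  refine ⟨U, Unitary.map_mem _ (Unitary.linearIsometryEquiv.symm e).2, fun x => ?_⟩
  rw [← Matrix.coe_toEuclideanCLM_eq_toEuclideanLin, StarAlgEquiv.apply_symm_apply]
  rfl

theorem abs_trace_le_card_of_mem_orthogonalGroup {n : Type*} [Fintype n] [DecidableEq n]
    {U : Matrix n n ℝ} (hU : U ∈ Matrix.orthogonalGroup n ℝ) : |U.trace| ≤ Fintype.card n :=
  calc |U.trace| ≤ ∑ a, |U a a| := Finset.abs_sum_le_sum_abs _ _
    _ ≤ ∑ _a : n, (1 : ℝ) := Finset.sum_le_sum fun a _ => entry_norm_bound_of_unitary hU a a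
    _ = Fintype.card n := by simp

variable {d : ℕ} (S : Matrix (Fin d) (Fin d) ℝ)

theorem exists_singularValueDecomposition :
    ∃ (v u : OrthonormalBasis (Fin d) ℝ (EuclideanSpace ℝ (Fin d))) (σ : Fin d → ℝ),
      (∀ k, 0 ≤ σ k) ∧ nuclearNorm S = ∑ k, σ k ∧
        ∀ k, Matrix.toEuclideanLin S (v k) = σ k • u k := by
  obtain ⟨v, u, hS⟩ := exists_orthonormalBasis_map_eq_singularValues_smul
    (Matrix.toEuclideanLin S) finrank_euclideanSpace_fin finrank_euclideanSpace_fin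
  exact ⟨v, u, fun k => (Matrix.toEuclideanLin S).singularValues k,
    fun k => LinearMap.singularValues_nonneg _ k, Finset.sum_range _, hS⟩

theorem trace_transpose_mul_le_mul_nuclearNorm (A : Matrix (Fin d) (Fin d) ℝ) {c : ℝ}
    (hA : ∀ x, ‖Matrix.toEuclideanLin A x‖ ≤ c * ‖x‖) :
    (Aᵀ * S).trace ≤ c * nuclearNorm S := by
  obtain ⟨v, u, σ, hσ, hnorm, hS⟩ := exists_singularValueDecomposition S
  rw [trace_transpose_mul_eq_sum_inner A S v, hnorm, Finset.mul_sum]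
  refine Finset.sum_le_sum fun k _ => ?_
  calc inner ℝ (Matrix.toEuclideanLin A (v k)) (Matrix.toEuclideanLin S (v k))
      ≤ ‖Matrix.toEuclideanLin A (v k)‖ * ‖Matrix.toEuclideanLin S (v k)‖ :=
        real_inner_le_norm _ _
    _ ≤ c * ‖v k‖ * ‖σ k • u k‖ := by
        rw [hS]
        gcongr
        exact hA _
    _ = c * σ k := by
        rw [norm_smul, v.norm_eq_one, u.norm_eq_one, mul_one, mul_one, Real.norm_of_nonneg (hσ k)]

theorem exists_mem_orthogonalGroup_trace_transpose_mul_eq_nuclearNorm :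
    ∃ O ∈ Matrix.orthogonalGroup (Fin d) ℝ, (Oᵀ * S).trace = nuclearNorm S := by
  obtain ⟨v, u, σ, _, hnorm, hS⟩ := exists_singularValueDecomposition S
  obtain ⟨O, hO, hOv⟩ := exists_mem_unitaryGroup_toEuclideanLin_eq (v.equiv u (Equiv.refl _))
  refine ⟨O, hO, ?_⟩
  rw [trace_transpose_mul_eq_sum_inner O S v, hnorm]
  refine Finset.sum_congr rfl fun k _ => ?_
  rw [hS, hOv, OrthonormalBasis.equiv_apply_basis, Equiv.refl_apply, inner_smul_right,
    real_inner_self_eq_norm_sq, u.norm_eq_one, one_pow, mul_one]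

theorem nuclearNorm_smul_of_mem_orthogonalGroup {O : Matrix (Fin d) (Fin d) ℝ}
    (hO : O ∈ Matrix.orthogonalGroup (Fin d) ℝ) {c : ℝ} (hc : 0 ≤ c) :
    nuclearNorm (c • O) = d * c := by
  obtain ⟨v, u, σ, hσ, hnorm, hS⟩ := exists_singularValueDecomposition (c • O)
  have hσc (k : Fin d) : σ k = c := by
    have h := congrArg norm (hS k)
    rw [norm_smul, map_smul, LinearMap.smul_apply, norm_smul,
      norm_toEuclideanLin_of_mem_unitaryGroup hO, v.norm_eq_one, u.norm_eq_one, mul_one, mul_one,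
      Real.norm_of_nonneg hc, Real.norm_of_nonneg (hσ k)] at h
    exact h.symm
  simp [hnorm, hσc]

theorem exists_finite_net_orthogonalGroup (d : ℕ) {ε : ℝ} (hε : 0 < ε) :
    ∃ 𝒩 : Finset (Matrix (Fin d) (Fin d) ℝ),
      (∀ O ∈ 𝒩, O ∈ Matrix.orthogonalGroup (Fin d) ℝ) ∧
      ∀ B ∈ Matrix.orthogonalGroup (Fin d) ℝ, ∃ O ∈ 𝒩,
        ∀ x, ‖Matrix.toEuclideanLin (B - O) x‖ ≤ ε * ‖x‖ := by
  let opNorm (A : Matrix (Fin d) (Fin d) ℝ) : ℝ :=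
    ‖Matrix.toEuclideanCLM (n := Fin d) (𝕜 := ℝ) A‖
  have hcont : Continuous opNorm := (LinearMap.continuous_of_finiteDimensional
    (Matrix.toEuclideanCLM (n := Fin d) (𝕜 := ℝ)).toAlgEquiv.toLinearMap).norm
  have hnhds (O : Matrix (Fin d) (Fin d) ℝ) : {B | opNorm (B - O) < ε} ∈ nhds O :=
    (isOpen_lt (hcont.comp (continuous_id.sub continuous_const)) continuous_const).mem_nhds
      (by simpa [opNorm] using hε)
  obtain ⟨𝒩, h𝒩, hcover⟩ := (isCompact_orthogonalGroup d).elim_nhds_subcover _ fun O _ => hnhds O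
  refine ⟨𝒩, h𝒩, fun B hB => ?_⟩
  obtain ⟨O, hO, hBO⟩ := Set.mem_iUnion₂.mp (hcover hB)
  exact ⟨O, hO, fun x => ContinuousLinearMap.le_of_opNorm_le _ (le_of_lt hBO) x⟩

theorem exists_finite_net_nuclearNorm_le_trace (d : ℕ) {ε : ℝ} (hε : 0 < ε) :
    ∃ 𝒩 : Finset (Matrix (Fin d) (Fin d) ℝ),
      (∀ O ∈ 𝒩, O ∈ Matrix.orthogonalGroup (Fin d) ℝ) ∧
      ∀ S : Matrix (Fin d) (Fin d) ℝ, ∃ O ∈ 𝒩, (1 - ε) * nuclearNorm S ≤ (Oᵀ * S).trace := by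
  obtain ⟨𝒩, h𝒩, hnet⟩ := exists_finite_net_orthogonalGroup d hε
  refine ⟨𝒩, h𝒩, fun S => ?_⟩
  obtain ⟨B, hB, hBS⟩ := exists_mem_orthogonalGroup_trace_transpose_mul_eq_nuclearNorm S
  obtain ⟨O, hO, hBO⟩ := hnet B hB
  refine ⟨O, hO, ?_⟩
  have h := trace_transpose_mul_le_mul_nuclearNorm S (B - O) hBO
  rw [Matrix.transpose_sub, Matrix.sub_mul, Matrix.trace_sub, hBS] at h
  linarith

end NuclearNorm

section Haar

open scoped Matrix

variable {G : SyncGroup} {d : ℕ}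

theorem SyncGroup.mat_mem (g : G.grp d) : SyncGroup.mat g ∈ Matrix.orthogonalGroup (Fin d) ℝ :=
  (g : Matrix.orthogonalGroup (Fin d) ℝ).2

theorem SyncGroup.mat_mul (g h : G.grp d) :
    SyncGroup.mat (g * h) = SyncGroup.mat g * SyncGroup.mat h := rfl

theorem SyncGroup.continuous_mat :
    Continuous (SyncGroup.mat : G.grp d → Matrix (Fin d) (Fin d) ℝ) :=
  continuous_subtype_val.comp continuous_subtype_val

instance SyncGroup.instIsProbabilityMeasureUnif (G : SyncGroup) (d : ℕ) :
    IsProbabilityMeasure (G.unif d) :=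
  ⟨Measure.haarMeasure_self (K₀ := (⊤ : TopologicalSpace.PositiveCompacts (G.grp d)))⟩

instance SyncGroup.instIsMulLeftInvariantUnif (G : SyncGroup) (d : ℕ) :
    (G.unif d).IsMulLeftInvariant :=
  inferInstanceAs (Measure.haarMeasure ⊤).IsMulLeftInvariant

theorem SyncGroup.exists_mat_eq_diagonal {s : Fin d → ℝ} (hs : ∀ a, s a * s a = 1)
    (hdet : G = SyncGroup.special → ∏ a, s a = 1) :
    ∃ h : G.grp d, SyncGroup.mat h = Matrix.diagonal s := by
  have hmem : Matrix.diagonal s ∈ Matrix.orthogonalGroup (Fin d) ℝ := by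
    simp [Matrix.mem_orthogonalGroup_iff, Matrix.diagonal_mul_diagonal, hs]
  refine ⟨⟨⟨_, hmem⟩, ?_⟩, rfl⟩
  cases G with
  | orthogonal => exact Subgroup.mem_top _
  | special => exact Matrix.det_diagonal.trans (hdet rfl)

theorem SyncGroup.exists_mat_mul_apply_eq_neg (hG : G = SyncGroup.special → 2 ≤ d) (a : Fin d) :
    ∃ h : G.grp d, ∀ (Q : Matrix (Fin d) (Fin d) ℝ) (b : Fin d),
      (SyncGroup.mat h * Q) a b = -Q a b := by
  suffices ∃ s : Fin d → ℝ, (∀ c, s c * s c = 1) ∧ s a = -1 ∧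
      (G = SyncGroup.special → ∏ c, s c = 1) by
    obtain ⟨s, hs, hsa, hdet⟩ := this
    obtain ⟨h, hh⟩ := SyncGroup.exists_mat_eq_diagonal hs hdet
    exact ⟨h, fun Q b => by rw [hh, Matrix.diagonal_mul, hsa, neg_one_mul]⟩
  let flip (c : Fin d) : Fin d → ℝ := Function.update 1 c (-1)
  have hflip (c c' : Fin d) : flip c c' * flip c c' = 1 := by
    obtain rfl | h := eq_or_ne c' c <;> simp [flip, *]
  by_cases hS : G = SyncGroup.special
  · have : Nontrivial (Fin d) := Fin.nontrivial_iff_two_le.mpr (hG hS)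
    obtain ⟨a', ha'⟩ := exists_ne a
    refine ⟨flip a * flip a', fun c => ?_, by simp [flip, ha'.symm], fun _ => ?_⟩
    · rw [Pi.mul_apply, mul_mul_mul_comm, hflip, hflip, mul_one]
    · simp [flip, Finset.prod_mul_distrib, Finset.prod_update_of_mem]
  · exact ⟨flip a, hflip a, by simp [flip], fun h => absurd h hS⟩

theorem SyncGroup.integrable_of_continuous {f : G.grp d → ℝ} (hf : Continuous f) :
    Integrable f (G.unif d) :=
  hf.integrable_of_hasCompactSupport (HasCompactSupport.of_compactSpace f)

theorem SyncGroup.integral_mat_apply_eq_zero (hG : G = SyncGroup.special → 2 ≤ d)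
    (a b : Fin d) : ∫ g, SyncGroup.mat g a b ∂G.unif d = 0 := by
  obtain ⟨h, hh⟩ := SyncGroup.exists_mat_mul_apply_eq_neg hG a
  have hinv := integral_mul_left_eq_self (μ := G.unif d) (fun g => SyncGroup.mat g a b) h
  simp only [SyncGroup.mat_mul, hh, integral_neg] at hinv
  linarith

theorem SyncGroup.integral_trace_mul_mat_mul_eq_zero (hG : G = SyncGroup.special → 2 ≤ d)
    (A B : Matrix (Fin d) (Fin d) ℝ) :
    ∫ g, (A * SyncGroup.mat g * B).trace ∂G.unif d = 0 := by
  have htrace (g : G.grp d) : (A * SyncGroup.mat g * B).trace =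
      ∑ b, ∑ a, (B * A) b a * SyncGroup.mat g a b := by
    rw [Matrix.trace_mul_comm, ← Matrix.mul_assoc]
    exact Finset.sum_congr rfl fun b _ => Matrix.mul_apply
  have hint (a b : Fin d) :
      Integrable (fun g : G.grp d => (B * A) b a * SyncGroup.mat g a b) (G.unif d) :=
    SyncGroup.integrable_of_continuous
      (continuous_const.mul (SyncGroup.continuous_mat.matrix_elem a b))
  simp only [htrace]
  rw [integral_finsetSum _ fun b _ => integrable_finsetSum _ fun a _ => hint a b]
  refine Finset.sum_eq_zero fun b _ => ?_
  rw [integral_finsetSum _ fun a _ => hint a b]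
  refine Finset.sum_eq_zero fun a _ => ?_
  rw [integral_const_mul, SyncGroup.integral_mat_apply_eq_zero hG, mul_zero]

end Haar

section Probability

variable {Ω : Type*} {mΩ : MeasurableSpace Ω} {μ : Measure Ω}

theorem mgf_le_cosh [IsProbabilityMeasure μ] {X : Ω → ℝ} (hX : AEMeasurable X μ)
    (hbound : ∀ᵐ ω ∂μ, |X ω| ≤ 1) (hmean : μ[X] = 0) (t : ℝ) : mgf X μ t ≤ Real.cosh t := by
  have hXint : Integrable X μ := Integrable.of_bound hX.aestronglyMeasurable 1 hbound
  calc mgf X μ t ≤ ∫ ω, (Real.cosh t + X ω * Real.sinh t) ∂μ := by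
        refine integral_mono_ae
          (integrable_exp_mul_of_mem_Icc hX (hbound.mono fun ω hω => abs_le.mp hω))
          ((integrable_const _).add (hXint.mul_const _)) (hbound.mono fun ω hω => ?_)
        simpa only [mul_comm t] using Real.exp_mul_le_cosh_add_mul_sinh hω t
    _ = Real.cosh t := by
        rw [integral_add (integrable_const _) (hXint.mul_const _), integral_mul_const, hmean,
          zero_mul, add_zero, integral_const, probReal_univ, one_smul]

theorem mgf_bernoulliMeasure_prod_le [IsProbabilityMeasure μ] (r : unitInterval) {Y : Ω → ℝ}
    (hY : Measurable Y) {t : ℝ} (hint : Integrable (fun ω => Real.exp (t * Y ω)) μ) :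
    mgf (fun x : Bool × Ω => if x.1 then Y x.2 else 0)
        ((bernoulliMeasure true false r).prod μ) t ≤
      Real.exp (r * (mgf Y μ t - 1)) := by
  have hmeas : Measurable fun x : Bool × Ω => Real.exp (t * if x.1 then Y x.2 else 0) :=
    ((Measurable.ite (measurable_fst (measurableSet_singleton true))
      (hY.comp measurable_snd) measurable_const).const_mul t).exp
  have hint' : Integrable (fun x : Bool × Ω => Real.exp (t * if x.1 then Y x.2 else 0))
      ((bernoulliMeasure true false r).prod μ) := by
    refine (integrable_prod_iff hmeas.aestronglyMeasurable).mpr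
      ⟨ae_of_all _ fun b => ?_, Integrable.of_finite⟩
    cases b
    · simp
    · simpa using hint
  calc mgf (fun x : Bool × Ω => if x.1 then Y x.2 else 0)
        ((bernoulliMeasure true false r).prod μ) t
      = r * (mgf Y μ t - 1) + 1 := by
        rw [mgf, integral_prod _ hint', integral_bernoulliMeasure]
        simp only [↓reduceIte, smul_eq_mul, Bool.false_eq_true, mul_zero, Real.exp_zero,
          integral_const, probReal_univ, mul_one, mgf]
        ring
    _ ≤ Real.exp (r * (mgf Y μ t - 1)) := Real.add_one_le_exp _

theorem indepFun_finsetSum_finsetSum_of_disjoint {ι α M N : Type*} [MeasurableSpace α]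
    [AddCommMonoid M] [MeasurableSpace M] [MeasurableAdd₂ M]
    [AddCommMonoid N] [MeasurableSpace N] [MeasurableAdd₂ N]
    {Z : ι → Ω → α} (hZ : iIndepFun Z μ) (hZm : ∀ i, Measurable (Z i))
    {f : ι → α → M} (hf : ∀ i, Measurable (f i)) {g : ι → α → N} (hg : ∀ i, Measurable (g i))
    {s t : Finset ι} (hst : Disjoint s t) :
    IndepFun (fun ω => ∑ i ∈ s, f i (Z i ω)) (fun ω => ∑ i ∈ t, g i (Z i ω)) μ := by
  simp only [← Finset.sum_coe_sort s, ← Finset.sum_coe_sort t]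
  exact (hZ.indepFun_finset s t hst hZm).comp
    (φ := fun x => ∑ i : s, f i (x i)) (ψ := fun x => ∑ i : t, g i (x i))
    (by fun_prop) (by fun_prop)

theorem mgf_finsetSum_le_exp_card_mul {ι : Type*} {X : ι → Ω → ℝ} (hX : iIndepFun X μ)
    (hXm : ∀ i, Measurable (X i)) (s : Finset ι) {t c : ℝ}
    (hc : ∀ i ∈ s, mgf (X i) μ t ≤ Real.exp c) :
    mgf (fun ω => ∑ i ∈ s, X i ω) μ t ≤ Real.exp (s.card * c) := by
  rw [← Finset.sum_fn, hX.mgf_sum hXm, Real.exp_nat_mul, ← Finset.prod_const]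
  exact Finset.prod_le_prod (fun i _ => mgf_nonneg) hc

theorem integrable_exp_mul_finsetSum [IsFiniteMeasure μ] {ι : Type*} {X : ι → Ω → ℝ}
    (hX : ∀ i, Measurable (X i)) {b : ℝ} (hb : ∀ i ω, |X i ω| ≤ b) (s : Finset ι) (t : ℝ) :
    Integrable (fun ω => Real.exp (t * ∑ i ∈ s, X i ω)) μ := by
  have hsum (ω : Ω) : |∑ i ∈ s, X i ω| ≤ s.card * b :=
    calc |∑ i ∈ s, X i ω| ≤ ∑ i ∈ s, |X i ω| := Finset.abs_sum_le_sum_abs _ _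
      _ ≤ s.card * b := by
        simpa only [nsmul_eq_mul] using Finset.sum_le_card_nsmul s _ b fun i _ => hb i ω
  exact integrable_exp_mul_of_mem_Icc (by fun_prop) (ae_of_all _ fun ω => abs_le.mp (hsum ω))

theorem measureReal_le_card_mul_of_subset_biUnion [IsFiniteMeasure μ] {ι : Type*} {s : Finset ι}
    {A : Set Ω} {E : ι → Set Ω} (hA : A ⊆ ⋃ i ∈ s, E i) {b : ℝ} (hE : ∀ i ∈ s, μ.real (E i) ≤ b) :
    μ.real A ≤ s.card * b :=
  calc μ.real A ≤ μ.real (⋃ i ∈ s, E i) := measureReal_mono hA (measure_ne_top μ _)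
    _ ≤ ∑ i ∈ s, μ.real (E i) := measureReal_biUnion_finset_le s E
    _ ≤ s.card * b := by
      simpa only [nsmul_eq_mul] using Finset.sum_le_card_nsmul s _ b hE

theorem one_sub_add_le_measureReal_inter_of_compl_le [IsProbabilityMeasure μ] {s t : Set Ω}
    {x y : ℝ} (hs : μ.real sᶜ ≤ x) (ht : μ.real tᶜ ≤ y) : 1 - (x + y) ≤ μ.real (s ∩ t) := by
  have h : μ.real Set.univ ≤ μ.real (s ∩ t) + (μ.real sᶜ + μ.real tᶜ) :=
    calc μ.real Set.univ = μ.real ((s ∩ t) ∪ (sᶜ ∪ tᶜ)) := by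
          rw [← Set.compl_inter, Set.union_compl_self]
      _ ≤ μ.real (s ∩ t) + μ.real (sᶜ ∪ tᶜ) := measureReal_union_le _ _
      _ ≤ μ.real (s ∩ t) + (μ.real sᶜ + μ.real tᶜ) := by
          gcongr
          exact measureReal_union_le _ _
  rw [probReal_univ] at h
  linarith

end Probability

section Blocks

open scoped Matrix

variable {n K d : ℕ} {G : SyncGroup} (C : Fin n → Fin K) (R : Fin n → G.grp d)

theorem IsClustering.card_filter_eq {C : Fin n → Fin K} (hC : IsClustering C) (k : Fin K) :
    ((Finset.univ.filter fun j => C j = k).card : ℝ) = n / K := by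
  have hK : (K : ℝ) ≠ 0 := Nat.cast_ne_zero.mpr k.pos.ne'
  exact (eq_div_iff hK).mpr (by exact_mod_cast (mul_comm _ _).trans (hC k))

/-- The coordinate `(min i j, max i j)` of the sample space that carries the data of the unordered
pair `{i, j}`. -/
def pairIdx (i j : Fin n) : Fin n × Fin n := (min i j, max i j)

theorem pairIdx_injective (i : Fin n) : Function.Injective (pairIdx i) := by
  intro j k h
  simp only [pairIdx, Prod.mk.injEq] at h
  rcases le_total i j with h1 | h1 <;> rcases le_total i k with h2 | h2 <;> simp_all

theorem cluster_pairIdx_eq_iff (i j : Fin n) :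
    C (pairIdx i j).1 = C (pairIdx i j).2 ↔ C j = C i := by
  rcases le_total i j with h | h <;> simp [pairIdx, h, eq_comm]

/-- The edge indicator and the group element of the unordered pair `{i, j}`. -/
def pairData (i j : Fin n) (ω : SGBMSpace n d G) : Bool × G.grp d :=
  (ω.1 (pairIdx i j), ω.2 (pairIdx i j))

/-- The block at `(i, j)` of the symmetric block matrix with block `Q` at `pairIdx i j`. -/
def orient (i j : Fin n) (Q : Matrix (Fin d) (Fin d) ℝ) : Matrix (Fin d) (Fin d) ℝ :=
  if i < j then Q else Qᵀ

/-- The indicator of an edge between the nodes `i` and `j` of one cluster. The diagonal blocks of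
the observation matrix are identities, so every node counts as its own neighbour. -/
def ownEdge (i j : Fin n) (edge : Bool) : ℝ := if j = i ∨ edge = true then 1 else 0

/-- The degree of `i` within its own cluster, with the self-loop. -/
def ownDegree (i : Fin n) (ω : SGBMSpace n d G) : ℝ :=
  ∑ j with C j = C i, ownEdge i j (pairData i j ω).1

/-- The normalized trace inner product of `O` with the summand `A i j * R j` of a block of `A V`,
for nodes `i`, `j` of different clusters that are joined by an edge with group element `g`. -/
noncomputable def alignment (O : Matrix (Fin d) (Fin d) ℝ) (i j : Fin n) (g : G.grp d) : ℝ :=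
  (Oᵀ * (orient i j (SyncGroup.mat g) * SyncGroup.mat (R j))).trace / d

/-- The normalized trace inner product of `O` with the `(i, k)` block of `A V`, for `k ≠ C i`. -/
noncomputable def crossAlignment (O : Matrix (Fin d) (Fin d) ℝ) (i : Fin n) (k : Fin K)
    (ω : SGBMSpace n d G) : ℝ :=
  ∑ j with C j = k, if (pairData i j ω).1 then alignment R O i j (pairData i j ω).2 else 0

theorem ownDegree_nonneg (i : Fin n) (ω : SGBMSpace n d G) : 0 ≤ ownDegree C i ω :=
  Finset.sum_nonneg fun j _ => by unfold ownEdge; split_ifs <;> norm_num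

theorem blk_mul_groundTruth (A : Matrix (Fin n × Fin d) (Fin n × Fin d) ℝ) (i : Fin n)
    (k : Fin K) :
    blk (A * groundTruth C R) i k = ∑ j with C j = k, blk A i j * SyncGroup.mat (R j) := by
  rw [Finset.sum_filter]
  ext a b
  simp only [blk, groundTruth, Matrix.of_apply, Matrix.mul_apply, Fintype.sum_prod_type,
    Matrix.sum_apply]
  refine Finset.sum_congr rfl fun j _ => ?_
  split_ifs <;> simp [Matrix.mul_apply]

theorem blk_observation_self (ω : SGBMSpace n d G) (i : Fin n) :
    blk (observation C R ω) i i = 1 := by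
  ext a b
  simp [blk, observation]

theorem blk_observation_of_ne (ω : SGBMSpace n d G) {i j : Fin n} (hij : j ≠ i) :
    blk (observation C R ω) i j =
      orient i j (obsUpper C R ω (pairIdx i j).1 (pairIdx i j).2) := by
  ext a b
  rcases lt_or_gt_of_ne hij with h | h
  · simp [blk, observation, orient, pairIdx, h, h.le, h.not_gt]
  · simp [blk, observation, orient, pairIdx, h, h.le]

theorem blk_observation_mul_mat_of_cluster_eq (ω : SGBMSpace n d G) {i j : Fin n}
    (h : C j = C i) :
    blk (observation C R ω) i j * SyncGroup.mat (R j) =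
      ownEdge i j (pairData i j ω).1 • SyncGroup.mat (R i) := by
  have hR : (SyncGroup.mat (R j))ᵀ * SyncGroup.mat (R j) = 1 :=
    (Matrix.mem_orthogonalGroup_iff' _ _).mp (SyncGroup.mat_mem (R j))
  obtain rfl | hij := eq_or_ne j i
  · simp [blk_observation_self, ownEdge]
  have horient : orient i j (SyncGroup.mat (R (pairIdx i j).1) *
      (SyncGroup.mat (R (pairIdx i j).2))ᵀ) = SyncGroup.mat (R i) * (SyncGroup.mat (R j))ᵀ := by
    rcases lt_or_gt_of_ne hij with h | h
    · simp [orient, pairIdx, h.le, h.not_gt]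
    · simp [orient, pairIdx, h, h.le]
  rw [blk_observation_of_ne C R ω hij, obsUpper, if_pos ((cluster_pairIdx_eq_iff C i j).mpr h)]
  by_cases hedge : ω.1 (pairIdx i j) = true
  · simp [hedge, pairData, ownEdge, horient, Matrix.mul_assoc, hR]
  · simp [hedge, pairData, ownEdge, orient, hij]

theorem blk_observation_of_cluster_ne (ω : SGBMSpace n d G) {i j : Fin n} (h : C j ≠ C i) :
    blk (observation C R ω) i j =
      if (pairData i j ω).1 then orient i j (SyncGroup.mat (pairData i j ω).2) else 0 := by
  rw [blk_observation_of_ne C R ω fun hji => h (congrArg C hji), obsUpper,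
    if_neg (mt (cluster_pairIdx_eq_iff C i j).mp h)]
  by_cases hedge : ω.1 (pairIdx i j) = true <;> simp [hedge, pairData, orient]

theorem blockNuclear_own (ω : SGBMSpace n d G) (i : Fin n) :
    blockNuclear (observation C R ω * groundTruth C R) i (C i) = d * ownDegree C i ω := by
  rw [← nuclearNorm_smul_of_mem_orthogonalGroup (SyncGroup.mat_mem (R i)) (ownDegree_nonneg C i ω)]
  change nuclearNorm (blk _ i (C i)) = _
  rw [blk_mul_groundTruth, ownDegree, Finset.sum_smul]
  congr 1
  exact Finset.sum_congr rfl fun j hj =>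
    blk_observation_mul_mat_of_cluster_eq C R ω (Finset.mem_filter.mp hj).2

theorem trace_transpose_mul_blk_eq (ω : SGBMSpace n d G) (hd : d ≠ 0)
    (O : Matrix (Fin d) (Fin d) ℝ) {i : Fin n} {k : Fin K} (hk : k ≠ C i) :
    (Oᵀ * blk (observation C R ω * groundTruth C R) i k).trace =
      d * crossAlignment C R O i k ω := by
  rw [blk_mul_groundTruth, crossAlignment, Matrix.mul_sum, Matrix.trace_sum, Finset.mul_sum]
  refine Finset.sum_congr rfl fun j hj => ?_
  have hji : C j ≠ C i := (Finset.mem_filter.mp hj).2 ▸ hk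
  rw [blk_observation_of_cluster_ne C R ω hji]
  split_ifs
  · exact (mul_div_cancel₀ _ (Nat.cast_ne_zero.mpr hd)).symm
  · simp

theorem exists_le_crossAlignment_sub_mul_ownDegree (hd : d ≠ 0)
    {𝒩 : Finset (Matrix (Fin d) (Fin d) ℝ)} {ε δ : ℝ} (hε0 : 0 ≤ ε) (hε1 : ε ≤ 1) (hδ : 0 ≤ δ)
    (hnet : ∀ S : Matrix (Fin d) (Fin d) ℝ, ∃ O ∈ 𝒩, (1 - ε) * nuclearNorm S ≤ (Oᵀ * S).trace)
    (ω : SGBMSpace n d G) {i : Fin n} {k : Fin K} (hk : k ≠ C i)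
    (hsep : blockNuclear (observation C R ω * groundTruth C R) i (C i) -
      blockNuclear (observation C R ω * groundTruth C R) i k < δ) :
    ∃ O ∈ 𝒩, -δ ≤ crossAlignment C R O i k ω - (1 - ε) * ownDegree C i ω := by
  obtain ⟨O, hO, htrace⟩ := hnet (blk (observation C R ω * groundTruth C R) i k)
  refine ⟨O, hO, ?_⟩
  rw [trace_transpose_mul_blk_eq C R ω hd O hk] at htrace
  rw [blockNuclear_own] at hsep
  change d * ownDegree C i ω - nuclearNorm _ < δ at hsep
  have hd1 : (1 : ℝ) ≤ d := Nat.one_le_cast.mpr (Nat.one_le_iff_ne_zero.mpr hd)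
  refine le_of_mul_le_mul_left ?_ (zero_lt_one.trans_le hd1)
  calc (d : ℝ) * -δ ≤ -δ := by nlinarith
    _ ≤ (1 - ε) * -δ := by nlinarith
    _ ≤ (1 - ε) * (nuclearNorm (blk (observation C R ω * groundTruth C R) i k) -
        d * ownDegree C i ω) :=
      mul_le_mul_of_nonneg_left (by linarith) (sub_nonneg.mpr hε1)
    _ ≤ d * (crossAlignment C R O i k ω - (1 - ε) * ownDegree C i ω) := by linarith

end Blocks

section Distribution

open scoped Matrix

variable {n K d : ℕ} {G : SyncGroup} (C : Fin n → Fin K) (R : Fin n → G.grp d)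
  (p q : unitInterval)

instance : IsProbabilityMeasure (sgbmMeasure C p q d G) := by
  unfold sgbmMeasure
  infer_instance

theorem measurePreserving_sgbmMeasure_pi :
    MeasurePreserving (fun (ω : SGBMSpace n d G) e => (ω.1 e, ω.2 e)) (sgbmMeasure C p q d G)
      (Measure.pi fun e : Fin n × Fin n =>
        (bernoulliMeasure true false (if C e.1 = C e.2 then p else q)).prod (G.unif d)) :=
  (measurePreserving_arrowProdEquivProdArrow Bool (G.grp d) (Fin n × Fin n)
    (fun e => bernoulliMeasure true false (if C e.1 = C e.2 then p else q))
    (fun _ => G.unif d)).symm _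

theorem measurePreserving_sgbmMeasure_coord (e : Fin n × Fin n) :
    MeasurePreserving (fun ω : SGBMSpace n d G => (ω.1 e, ω.2 e)) (sgbmMeasure C p q d G)
      ((bernoulliMeasure true false (if C e.1 = C e.2 then p else q)).prod (G.unif d)) :=
  (measurePreserving_eval (fun e : Fin n × Fin n =>
    (bernoulliMeasure true false (if C e.1 = C e.2 then p else q)).prod (G.unif d)) e).comp
    (measurePreserving_sgbmMeasure_pi C p q)

theorem iIndepFun_sgbmMeasure_coord :
    iIndepFun (fun (e : Fin n × Fin n) (ω : SGBMSpace n d G) => (ω.1 e, ω.2 e))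
      (sgbmMeasure C p q d G) := by
  have hcoord (e : Fin n × Fin n) := measurePreserving_sgbmMeasure_coord (d := d) (G := G) C p q e
  rw [iIndepFun_iff_map_fun_eq_pi_map fun e => (hcoord e).measurable.aemeasurable,
    (measurePreserving_sgbmMeasure_pi C p q).map_eq]
  simp only [(hcoord _).map_eq]

theorem measurePreserving_pairData (i j : Fin n) :
    MeasurePreserving (pairData (G := G) (d := d) i j) (sgbmMeasure C p q d G)
      ((bernoulliMeasure true false (if C j = C i then p else q)).prod (G.unif d)) := by
  have hcoord := measurePreserving_sgbmMeasure_coord (d := d) (G := G) C p q (pairIdx i j)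
  simp only [cluster_pairIdx_eq_iff] at hcoord
  exact hcoord

theorem iIndepFun_pairData (i : Fin n) :
    iIndepFun (pairData (G := G) (d := d) i) (sgbmMeasure C p q d G) :=
  iIndepFun.precomp (g := pairIdx i) (pairIdx_injective i) (iIndepFun_sgbmMeasure_coord C p q)

theorem mgf_comp_pairData (i j : Fin n) {f : Bool × G.grp d → ℝ} (hf : Measurable f) (t : ℝ) :
    mgf (fun ω => f (pairData i j ω)) (sgbmMeasure C p q d G) t =
      mgf f ((bernoulliMeasure true false (if C j = C i then p else q)).prod (G.unif d)) t := by
  have hpair := measurePreserving_pairData (d := d) (G := G) C p q i j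
  rw [← hpair.map_eq, mgf_map hpair.measurable.aemeasurable
    (hf.const_mul t).exp.aestronglyMeasurable]
  rfl

theorem measurable_ownEdge (i j : Fin n) :
    Measurable fun x : Bool × G.grp d => ownEdge i j x.1 :=
  (measurable_of_countable (ownEdge i j)).comp measurable_fst

theorem continuous_alignment (O : Matrix (Fin d) (Fin d) ℝ) (i j : Fin n) :
    Continuous (alignment R O i j) := by
  have horient : Continuous fun g : G.grp d => orient i j (SyncGroup.mat g) := by
    unfold orient
    split_ifs
    · exact SyncGroup.continuous_mat
    · exact SyncGroup.continuous_mat.matrix_transpose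
  exact (continuous_const.matrix_mul (horient.matrix_mul continuous_const)).matrix_trace.div_const _

theorem measurable_ite_alignment (O : Matrix (Fin d) (Fin d) ℝ) (i j : Fin n) :
    Measurable fun x : Bool × G.grp d => if x.1 then alignment R O i j x.2 else 0 :=
  Measurable.ite (measurable_fst (measurableSet_singleton true))
    ((continuous_alignment R O i j).measurable.comp measurable_snd) measurable_const

theorem abs_alignment_le_one {O : Matrix (Fin d) (Fin d) ℝ}
    (hO : O ∈ Matrix.orthogonalGroup (Fin d) ℝ) (i j : Fin n) (g : G.grp d) :
    |alignment R O i j g| ≤ 1 := by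
  have horient : orient i j (SyncGroup.mat g) ∈ Matrix.orthogonalGroup (Fin d) ℝ := by
    unfold orient
    split_ifs
    · exact SyncGroup.mat_mem g
    · exact Matrix.transpose_mem_unitaryGroup_iff.mpr (SyncGroup.mat_mem g)
  have htrace := abs_trace_le_card_of_mem_orthogonalGroup
    (mul_mem (Matrix.transpose_mem_unitaryGroup_iff.mpr hO)
      (mul_mem horient (SyncGroup.mat_mem (R j))))
  rw [Fintype.card_fin] at htrace
  rw [alignment, abs_div, Nat.abs_cast]
  exact div_le_one_of_le₀ htrace (Nat.cast_nonneg d)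

theorem integral_alignment_eq_zero (hG : G = SyncGroup.special → 2 ≤ d)
    (O : Matrix (Fin d) (Fin d) ℝ) (i j : Fin n) :
    ∫ g, alignment R O i j g ∂G.unif d = 0 := by
  have htrace (A B Q : Matrix (Fin d) (Fin d) ℝ) :
      (Aᵀ * (Qᵀ * B)).trace = (Bᵀ * Q * A).trace := by
    rw [← Matrix.trace_transpose]
    simp [Matrix.mul_assoc]
  unfold alignment orient
  rw [integral_div]
  split_ifs
  · simp only [← Matrix.mul_assoc, SyncGroup.integral_trace_mul_mat_mul_eq_zero hG, zero_div]
  · simp only [htrace, SyncGroup.integral_trace_mul_mat_mul_eq_zero hG, zero_div]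

theorem mgf_ownEdge_le (i j : Fin n) {θ : ℝ} (hθ : 0 ≤ θ) :
    mgf (fun x : Bool × G.grp d => ownEdge i j x.1)
        ((bernoulliMeasure true false p).prod (G.unif d)) (-θ) ≤
      Real.exp (p * (Real.exp (-θ) - 1)) := by
  obtain rfl | hij := eq_or_ne j i
  · have hexp : Real.exp (-θ) ≤ 1 := Real.exp_le_one_iff.mpr (neg_nonpos.mpr hθ)
    calc mgf (fun x : Bool × G.grp d => ownEdge j j x.1)
          ((bernoulliMeasure true false p).prod (G.unif d)) (-θ)
        = Real.exp (-θ) := by simp [ownEdge]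
      _ ≤ p * (Real.exp (-θ) - 1) + 1 := by nlinarith [p.2.2]
      _ ≤ Real.exp (p * (Real.exp (-θ) - 1)) := Real.add_one_le_exp _
  · simpa [ownEdge, hij] using mgf_bernoulliMeasure_prod_le (μ := G.unif d) p
      (Y := fun _ => 1) measurable_const (integrable_const (Real.exp (-θ * 1)))

theorem mgf_ite_alignment_le (hG : G = SyncGroup.special → 2 ≤ d)
    {O : Matrix (Fin d) (Fin d) ℝ} (hO : O ∈ Matrix.orthogonalGroup (Fin d) ℝ) (i j : Fin n)
    (l : ℝ) :
    mgf (fun x : Bool × G.grp d => if x.1 then alignment R O i j x.2 else 0)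
        ((bernoulliMeasure true false q).prod (G.unif d)) l ≤
      Real.exp (q * (Real.cosh l - 1)) := by
  have hcont := continuous_alignment R O i j
  refine (mgf_bernoulliMeasure_prod_le q hcont.measurable
    (SyncGroup.integrable_of_continuous (hcont.const_mul l).rexp)).trans ?_
  gcongr
  · exact q.2.1
  · exact mgf_le_cosh hcont.aemeasurable
      (ae_of_all _ (abs_alignment_le_one R hO i j)) (integral_alignment_eq_zero R hG O i j) l

variable {C}

theorem mgf_ownDegree_le (hC : IsClustering C) (i : Fin n) {θ : ℝ} (hθ : 0 ≤ θ) :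
    mgf (ownDegree C i) (sgbmMeasure C p q d G) (-θ) ≤
      Real.exp (n / K * (p * (Real.exp (-θ) - 1))) := by
  have h := mgf_finsetSum_le_exp_card_mul
    ((iIndepFun_pairData (d := d) (G := G) C p q i).comp (fun j x => ownEdge i j x.1)
      fun j => measurable_ownEdge i j)
    (fun j => (measurable_ownEdge i j).comp (measurePreserving_pairData C p q i j).measurable)
    (Finset.univ.filter fun j => C j = C i) fun j hj => by
      have hji := (Finset.mem_filter.mp hj).2
      refine (mgf_comp_pairData C p q i j (measurable_ownEdge i j) (-θ)).trans_le ?_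
      simpa only [hji, if_true] using mgf_ownEdge_le p i j hθ
  rw [hC.card_filter_eq] at h
  exact h

theorem mgf_crossAlignment_le (hC : IsClustering C) (hG : G = SyncGroup.special → 2 ≤ d)
    {O : Matrix (Fin d) (Fin d) ℝ} (hO : O ∈ Matrix.orthogonalGroup (Fin d) ℝ) {i : Fin n}
    {k : Fin K} (hk : k ≠ C i) (l : ℝ) :
    mgf (crossAlignment C R O i k) (sgbmMeasure C p q d G) l ≤
      Real.exp (n / K * (q * (Real.cosh l - 1))) := by
  have h := mgf_finsetSum_le_exp_card_mul
    ((iIndepFun_pairData C p q i).comp _ fun j => measurable_ite_alignment R O i j)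
    (fun j => (measurable_ite_alignment R O i j).comp
      (measurePreserving_pairData C p q i j).measurable)
    (Finset.univ.filter fun j => C j = k) fun j hj => by
      have hji : C j ≠ C i := (Finset.mem_filter.mp hj).2 ▸ hk
      refine (mgf_comp_pairData C p q i j (measurable_ite_alignment R O i j) l).trans_le ?_
      simpa only [hji, if_false] using mgf_ite_alignment_le R q hG hO i j l
  rw [hC.card_filter_eq] at h
  exact h

theorem indepFun_crossAlignment_ownDegree (O : Matrix (Fin d) (Fin d) ℝ) {i : Fin n}
    {k : Fin K} (hk : k ≠ C i) :
    IndepFun (crossAlignment C R O i k) (ownDegree C i) (sgbmMeasure C p q d G) :=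
  indepFun_finsetSum_finsetSum_of_disjoint (iIndepFun_pairData C p q i)
    (fun j => (measurePreserving_pairData C p q i j).measurable)
    (fun j => measurable_ite_alignment R O i j) (fun j => measurable_ownEdge i j)
    (Finset.disjoint_filter.mpr fun _ _ h h' => hk (h.symm.trans h'))

end Distribution

section Tails

variable {n K d : ℕ} {G : SyncGroup} {C : Fin n → Fin K} (R : Fin n → G.grp d)
  (p q : unitInterval)

theorem integrable_exp_mul_ownDegree (i : Fin n) (t : ℝ) :
    Integrable (fun ω => Real.exp (t * ownDegree C i ω)) (sgbmMeasure C p q d G) :=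
  integrable_exp_mul_finsetSum
    (fun j => (measurable_ownEdge i j).comp (measurePreserving_pairData C p q i j).measurable)
    (b := 1) (fun j ω => by dsimp only [Function.comp_apply, ownEdge]; split_ifs <;> simp) _ t

theorem integrable_exp_mul_crossAlignment {O : Matrix (Fin d) (Fin d) ℝ}
    (hO : O ∈ Matrix.orthogonalGroup (Fin d) ℝ) (i : Fin n) (k : Fin K) (t : ℝ) :
    Integrable (fun ω => Real.exp (t * crossAlignment C R O i k ω)) (sgbmMeasure C p q d G) :=
  integrable_exp_mul_finsetSum
    (fun j => (measurable_ite_alignment R O i j).comp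
      (measurePreserving_pairData C p q i j).measurable)
    (b := 1) (fun j ω => by
      dsimp only [Function.comp_apply]
      split_ifs
      · exact abs_alignment_le_one R hO i j _
      · simp) _ t

theorem measureReal_ownDegree_le_le_exp (hC : IsClustering C) (i : Fin n) {r : ℝ} (hr0 : 0 < r)
    (hr1 : r ≤ 1) :
    (sgbmMeasure C p q d G).real {ω | ownDegree C i ω ≤ r * (n / K * p)} ≤
      Real.exp (-(n / K * p * (1 - r + r * Real.log r))) := by
  have hlog : 0 ≤ -Real.log r := neg_nonneg.mpr (Real.log_nonpos hr0.le hr1)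
  have hmgf := mgf_ownDegree_le (d := d) (G := G) p q hC i hlog
  rw [neg_neg, Real.exp_log hr0] at hmgf
  calc (sgbmMeasure C p q d G).real {ω | ownDegree C i ω ≤ r * (n / K * p)}
      ≤ Real.exp (-Real.log r * (r * (n / K * p))) *
          mgf (ownDegree C i) (sgbmMeasure C p q d G) (Real.log r) :=
        measure_le_le_exp_mul_mgf _ (neg_nonneg.mp hlog) (integrable_exp_mul_ownDegree p q i _)
    _ ≤ Real.exp (-Real.log r * (r * (n / K * p))) * Real.exp (n / K * (p * (r - 1))) := by
        gcongr
    _ = Real.exp (-(n / K * p * (1 - r + r * Real.log r))) := by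
        rw [← Real.exp_add]
        ring_nf

theorem measureReal_le_crossAlignment_sub_le_exp (hC : IsClustering C)
    (hG : G = SyncGroup.special → 2 ≤ d) {O : Matrix (Fin d) (Fin d) ℝ}
    (hO : O ∈ Matrix.orthogonalGroup (Fin d) ℝ) {i : Fin n} {k : Fin K} (hk : k ≠ C i)
    {l r : ℝ} (hl : 0 ≤ l) (hr : 0 ≤ r) (x : ℝ) :
    (sgbmMeasure C p q d G).real {ω | x ≤ crossAlignment C R O i k ω - r * ownDegree C i ω} ≤
      Real.exp (-l * x + n / K * (q * (Real.cosh l - 1) + p * (Real.exp (-(l * r)) - 1))) := by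
  set μ := sgbmMeasure C p q d G
  let Y : SGBMSpace n d G → ℝ := fun ω => -r * ownDegree C i ω
  have hindep : IndepFun (crossAlignment C R O i k) Y μ :=
    (indepFun_crossAlignment_ownDegree R p q O hk).comp measurable_id (measurable_const_mul (-r))
  have hint : Integrable (fun ω => Real.exp (l * crossAlignment C R O i k ω)) μ :=
    integrable_exp_mul_crossAlignment R p q hO i k l
  have hintY : Integrable (fun ω => Real.exp (l * Y ω)) μ := by
    simpa only [Y, ← mul_assoc] using integrable_exp_mul_ownDegree p q i (l * -r)
  have hmgfY : mgf Y μ l ≤ Real.exp (n / K * (p * (Real.exp (-(l * r)) - 1))) := by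
    rw [mgf_const_mul, neg_mul, mul_comm]
    exact mgf_ownDegree_le p q hC i (mul_nonneg hl hr)
  calc μ.real {ω | x ≤ crossAlignment C R O i k ω - r * ownDegree C i ω}
      = μ.real {ω | x ≤ (crossAlignment C R O i k + Y) ω} := by
        simp only [Pi.add_apply, Y, neg_mul, ← sub_eq_add_neg]
    _ ≤ Real.exp (-l * x) * mgf (crossAlignment C R O i k + Y) μ l :=
        measure_ge_le_exp_mul_mgf _ hl (hindep.integrable_exp_mul_add hint hintY)
    _ = Real.exp (-l * x) * (mgf (crossAlignment C R O i k) μ l * mgf Y μ l) := by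
        rw [hindep.mgf_add hint.aestronglyMeasurable hintY.aestronglyMeasurable]
    _ ≤ Real.exp (-l * x) * (Real.exp (n / K * (q * (Real.cosh l - 1))) *
          Real.exp (n / K * (p * (Real.exp (-(l * r)) - 1)))) := by
        gcongr
        exacts [mgf_nonneg, mgf_crossAlignment_le R p q hC hG hO hk l]
    _ = Real.exp (-l * x + n / K * (q * (Real.cosh l - 1) + p * (Real.exp (-(l * r)) - 1))) := by
        rw [← Real.exp_add, ← Real.exp_add]
        ring_nf

end Tails

section Exponents

theorem exists_pos_cosh_sub_one_add_exp_neg_sub_one_lt {a τ : ℝ} (hτ : 0 < τ) (ha : 1 + τ < a) :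
    ∃ l : ℝ, 0 < l ∧ τ ^ 2 / 2 * (Real.cosh l - 1) + a * (Real.exp (-l) - 1) < -1 := by
  set s := Real.sqrt (a + τ ^ 2 / 4)
  have hs2 : s ^ 2 = a + τ ^ 2 / 4 := Real.sq_sqrt (by nlinarith [sq_nonneg τ])
  have hs : 1 + τ / 2 < s := Real.lt_sqrt_of_sq_lt (by nlinarith)
  have hs0 : 0 < s := by linarith
  -- `exp l = 2 * s / τ` is the critical point of the exponent.
  refine ⟨Real.log (2 * s / τ), Real.log_pos ((one_lt_div hτ).mpr (by linarith)), ?_⟩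
  rw [Real.cosh_eq, Real.exp_neg, Real.exp_log (by positivity), eq_sub_of_add_eq hs2.symm]
  calc τ ^ 2 / 2 * ((2 * s / τ + (2 * s / τ)⁻¹) / 2 - 1) +
        (s ^ 2 - τ ^ 2 / 4) * ((2 * s / τ)⁻¹ - 1)
      = -(s - τ / 2) ^ 2 := by
        field_simp
        ring
    _ < -1 := by nlinarith

theorem exists_separation_exponent_lt {a b : ℝ} (hb : 0 < b) (ha : 1 + Real.sqrt (2 * b) < a) :
    ∃ l ε : ℝ, 0 < l ∧ 0 < ε ∧ ε < 1 ∧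
      l * (ε * a) + (b * (Real.cosh l - 1) + a * (Real.exp (-(l * (1 - ε))) - 1)) < -1 := by
  obtain ⟨l, hl, hlt⟩ :=
    exists_pos_cosh_sub_one_add_exp_neg_sub_one_lt (Real.sqrt_pos.mpr (by positivity)) ha
  rw [Real.sq_sqrt (by positivity), mul_div_cancel_left₀ b two_ne_zero] at hlt
  let f (ε : ℝ) : ℝ :=
    l * (ε * a) + (b * (Real.cosh l - 1) + a * (Real.exp (-(l * (1 - ε))) - 1))
  have hf : ContinuousAt f 0 := Continuous.continuousAt (by fun_prop)
  have hf0 : f 0 < -1 := by simpa [f] using hlt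
  have hnear : ∀ᶠ ε in nhdsWithin (0 : ℝ) (Set.Ioi 0), f ε < -1 :=
    (hf.eventually_lt_const hf0).filter_mono nhdsWithin_le_nhds
  obtain ⟨ε, hε, hε0, hε1⟩ := (hnear.and (Ioo_mem_nhdsGT (zero_lt_one' ℝ))).exists
  exact ⟨l, ε, hl, hε0, hε1, hε⟩

theorem exists_pos_eventually_mul_rpow_neg_add_le {M η₁ η₂ : ℝ} (hM : 0 ≤ M) (h₁ : 0 < η₁)
    (h₂ : 0 < η₂) :
    ∃ c : ℝ, 0 < c ∧
      ∀ᶠ x : ℝ in Filter.atTop, M * x ^ (-η₁) + x ^ (-η₂) ≤ x ^ (-c) := by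
  have hη : 0 < min η₁ η₂ := lt_min h₁ h₂
  refine ⟨min η₁ η₂ / 2, half_pos hη, ?_⟩
  filter_upwards [Filter.eventually_ge_atTop 1,
    (tendsto_rpow_atTop (half_pos hη)).eventually_ge_atTop (M + 1)] with x hx hMx
  calc M * x ^ (-η₁) + x ^ (-η₂)
      ≤ M * x ^ (-min η₁ η₂) + x ^ (-min η₁ η₂) := by
        gcongr
        exacts [min_le_left _ _, min_le_right _ _]
    _ = (M + 1) * x ^ (-min η₁ η₂) := by ring
    _ ≤ x ^ (min η₁ η₂ / 2) * x ^ (-min η₁ η₂) := by gcongr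
    _ = x ^ (-(min η₁ η₂ / 2)) := by
        rw [← Real.rpow_add (zero_lt_one.trans_le hx)]
        ring_nf

variable {K : ℕ} {α β : ℝ}

theorem sqrt_two_mul_mul_pos (hK : K ≠ 0) (hβ : 0 < β) : 0 < Real.sqrt (2 * K * β) := by
  have : (0 : ℝ) < K := Nat.cast_pos.mpr (Nat.pos_of_ne_zero hK)
  positivity

theorem InRegion.lt_sub_sub_mul_log (h : InRegion K α β) (hK : K ≠ 0) (hβ : 0 < β) :
    (K : ℝ) < α - Real.sqrt (2 * K * β) -
      Real.sqrt (2 * K * β) * Real.log (α / Real.sqrt (2 * K * β)) := by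
  have hs := sqrt_two_mul_mul_pos hK hβ
  have hlt := h.2
  rw [mul_div_assoc, Real.log_mul (Real.exp_pos 1).ne' (div_pos (hs.trans h.1) hs).ne',
    Real.log_exp] at hlt
  linarith

theorem InRegion.one_add_sqrt_lt (h : InRegion K α β) (hK : K ≠ 0) (hβ : 0 < β) :
    1 + Real.sqrt (2 * (β / K)) < α / K := by
  have hs := sqrt_two_mul_mul_pos hK hβ
  have hK0 : (0 : ℝ) < K := Nat.cast_pos.mpr (Nat.pos_of_ne_zero hK)
  have hlog : 0 < Real.log (α / Real.sqrt (2 * K * β)) := Real.log_pos ((one_lt_div hs).mpr h.1)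
  have hsqrt : Real.sqrt (2 * K * β) = Real.sqrt (2 * (β / K)) * K := by
    rw [show 2 * K * β = 2 * (β / K) * (K : ℝ) ^ 2 by field_simp, Real.sqrt_mul (by positivity),
      Real.sqrt_sq hK0.le]
  rw [lt_div_iff₀ hK0, add_mul, one_mul, ← hsqrt]
  linarith [h.lt_sub_sub_mul_log hK hβ, mul_pos hs hlog]

theorem exists_inRegion_sqrt_sub_sqrt_lt (hK : K ≠ 0) :
    ∃ α β : ℝ, 0 < α ∧ 0 < β ∧ InRegion K α β ∧ Real.sqrt α - Real.sqrt β < Real.sqrt K := by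
  have hK0 : (0 : ℝ) < K := Nat.cast_pos.mpr (Nat.pos_of_ne_zero hK)
  have hs : Real.sqrt (2 * K * (200 * K)) = 20 * K := by
    rw [show (2 * K * (200 * K) : ℝ) = (20 * K) ^ 2 by ring, Real.sqrt_sq (by positivity)]
  have hlog : Real.log 10 < 4 := by
    rw [Real.log_lt_iff_lt_exp (by norm_num)]
    calc (10 : ℝ) < 2 ^ 4 := by norm_num
      _ < Real.exp 1 ^ 4 := by
        gcongr
        linarith [Real.exp_one_gt_d9]
      _ = Real.exp 4 := by
        rw [← Real.exp_nat_mul]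
        norm_num
  refine ⟨200 * K, 200 * K, by positivity, by positivity, ⟨?_, ?_⟩, ?_⟩
  · rw [hs]
    linarith
  · rw [hs, show Real.exp 1 * (200 * K) / (20 * K) = Real.exp 1 * 10 by field_simp; norm_num,
      Real.log_mul (Real.exp_pos 1).ne' (by norm_num), Real.log_exp]
    nlinarith
  · rw [sub_self]
    exact Real.sqrt_pos.mpr hK0

end Exponents

section HighProbability

open scoped Matrix

variable {n K d : ℕ} {G : SyncGroup} {C : Fin n → Fin K} (R : Fin n → G.grp d)
  (p q : unitInterval)

theorem measureReal_compl_preservesBySeparation_le (hd : d ≠ 0)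
    {𝒩 : Finset (Matrix (Fin d) (Fin d) ℝ)} {ε δ B : ℝ} (hε0 : 0 ≤ ε) (hε1 : ε ≤ 1) (hδ : 0 < δ)
    (hnet : ∀ S : Matrix (Fin d) (Fin d) ℝ, ∃ O ∈ 𝒩, (1 - ε) * nuclearNorm S ≤ (Oᵀ * S).trace)
    (hB0 : 0 ≤ B)
    (hB : ∀ i k, k ≠ C i → ∀ O ∈ 𝒩, (sgbmMeasure C p q d G).real
      {ω | -δ ≤ crossAlignment C R O i k ω - (1 - ε) * ownDegree C i ω} ≤ B) :
    (sgbmMeasure C p q d G).real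
        {ω | PreservesBySeparation (observation C R ω) C (groundTruth C R) δ}ᶜ ≤
      n * K * 𝒩.card * B := by
  let s : Finset (Fin n × Fin K) := Finset.univ.filter fun x => x.2 ≠ C x.1
  let E (x : (Fin n × Fin K) × Matrix (Fin d) (Fin d) ℝ) : Set (SGBMSpace n d G) :=
    {ω | -δ ≤ crossAlignment C R x.2 x.1.1 x.1.2 ω - (1 - ε) * ownDegree C x.1.1 ω}
  have hcover : {ω | PreservesBySeparation (observation C R ω) C (groundTruth C R) δ}ᶜ ⊆
      ⋃ x ∈ s ×ˢ 𝒩, E x := by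
    intro ω hω
    obtain ⟨i, k, hk, hsep⟩ : ∃ i k, k ≠ C i ∧
        blockNuclear (observation C R ω * groundTruth C R) i (C i) -
          blockNuclear (observation C R ω * groundTruth C R) i k < δ := by
      by_contra! h
      exact hω ⟨hδ, h⟩
    obtain ⟨O, hO, hle⟩ :=
      exists_le_crossAlignment_sub_mul_ownDegree C R hd hε0 hε1 hδ.le hnet ω hk hsep
    exact Set.mem_biUnion (x := ((i, k), O))
      (Finset.mem_product.mpr ⟨Finset.mem_filter.mpr ⟨Finset.mem_univ _, hk⟩, hO⟩) hle
  have hs : s.card ≤ n * K := by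
    simpa using Finset.card_le_univ s
  calc _ ≤ (s ×ˢ 𝒩).card * B := by
        refine measureReal_le_card_mul_of_subset_biUnion hcover fun x hx => ?_
        obtain ⟨hxs, hxO⟩ := Finset.mem_product.mp hx
        exact hB x.1.1 x.1.2 (Finset.mem_filter.mp hxs).2 x.2 hxO
    _ ≤ n * K * 𝒩.card * B := by
        rw [Finset.card_product]
        gcongr
        exact_mod_cast Nat.mul_le_mul_right _ hs

theorem measureReal_compl_forall_le_blockNuclear_own_le (hd : d ≠ 0) {x B : ℝ}
    (hB : ∀ i, (sgbmMeasure C p q d G).real {ω | ownDegree C i ω ≤ x} ≤ B) :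
    (sgbmMeasure C p q d G).real
        {ω | ∀ i, x ≤ blockNuclear (observation C R ω * groundTruth C R) i (C i)}ᶜ ≤ n * B := by
  have hcover : {ω | ∀ i, x ≤ blockNuclear (observation C R ω * groundTruth C R) i (C i)}ᶜ ⊆
      ⋃ i ∈ Finset.univ, {ω | ownDegree C i ω ≤ x} := by
    intro ω hω
    obtain ⟨i, hi⟩ := not_forall.mp hω
    rw [not_le, blockNuclear_own] at hi
    have hle : ownDegree C i ω ≤ d * ownDegree C i ω := le_mul_of_one_le_left
      (ownDegree_nonneg C i ω) (Nat.one_le_cast.mpr (Nat.one_le_iff_ne_zero.mpr hd))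
    exact Set.mem_biUnion (Finset.mem_univ i) (hle.trans hi.le)
  simpa only [Finset.card_univ, Fintype.card_fin] using
    measureReal_le_card_mul_of_subset_biUnion hcover fun i _ => hB i

end HighProbability

section LogarithmicDegrees

variable {K d : ℕ} {G : SyncGroup} {α β : ℝ}

theorem div_mul_mul_log_div {n : ℕ} (hn : n ≠ 0) (K : ℕ) (α : ℝ) :
    (n : ℝ) / K * (α * Real.log n / n) = α / K * Real.log n := by
  field_simp

theorem nat_mul_exp_mul_log {n : ℕ} (hn : n ≠ 0) (x : ℝ) :
    n * Real.exp (x * Real.log n) = (n : ℝ) ^ (1 + x) := by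
  have hn0 : (0 : ℝ) < n := Nat.cast_pos.mpr (Nat.pos_of_ne_zero hn)
  rw [Real.rpow_add hn0, Real.rpow_one, Real.rpow_def_of_pos hn0 x, mul_comm x]

theorem exists_measureReal_compl_preservesBySeparation_le_rpow (hK : K ≠ 0) (hd : d ≠ 0)
    (hG : G = SyncGroup.special → 2 ≤ d) (hβ : 0 < β)
    (hlt : 1 + Real.sqrt (2 * (β / K)) < α / K) :
    ∃ χ η M : ℝ, 0 < χ ∧ 0 < η ∧ 0 ≤ M ∧ ∀ n : ℕ, 2 ≤ n → ∀ p q : unitInterval,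
      (p : ℝ) = α * Real.log n / n → (q : ℝ) = β * Real.log n / n →
      ∀ (C : Fin n → Fin K) (R : Fin n → G.grp d), IsClustering C →
        (sgbmMeasure C p q d G).real {ω | PreservesBySeparation (observation C R ω) C
          (groundTruth C R) (χ * (n / K) * p)}ᶜ ≤ M * (n : ℝ) ^ (-η) := by
  have hK0 : (0 : ℝ) < K := Nat.cast_pos.mpr (Nat.pos_of_ne_zero hK)
  have hα : 0 < α / K := by linarith [Real.sqrt_nonneg (2 * (β / K))]
  obtain ⟨l, ε, hl, hε0, hε1, hF⟩ := exists_separation_exponent_lt (div_pos hβ hK0) hlt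
  obtain ⟨𝒩, h𝒩, hnet⟩ := exists_finite_net_nuclearNorm_le_trace d hε0
  set F := l * (ε * (α / K)) +
    (β / K * (Real.cosh l - 1) + α / K * (Real.exp (-(l * (1 - ε))) - 1)) with hFdef
  refine ⟨ε, -(1 + F), K * 𝒩.card, hε0, by linarith, by positivity,
    fun n hn p q hp hq C R hC => ?_⟩
  have hn0 : n ≠ 0 := by lia
  have hlog : 0 < Real.log n := Real.log_pos (Nat.one_lt_cast.mpr hn)
  have hmp : (n : ℝ) / K * p = α / K * Real.log n := hp ▸ div_mul_mul_log_div hn0 K α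
  have hmq : (n : ℝ) / K * q = β / K * Real.log n := hq ▸ div_mul_mul_log_div hn0 K β
  rw [mul_assoc, hmp]
  calc _ ≤ n * K * 𝒩.card * Real.exp (F * Real.log n) := by
        refine measureReal_compl_preservesBySeparation_le R p q hd hε0.le hε1.le (by positivity)
          hnet (Real.exp_pos _).le fun i k hk O hO => ?_
        refine (measureReal_le_crossAlignment_sub_le_exp R p q hC hG (h𝒩 O hO) hk hl.le
          (sub_nonneg.mpr hε1.le) _).trans_eq ?_
        rw [mul_add, ← mul_assoc _ (q : ℝ), ← mul_assoc _ (p : ℝ), hmp, hmq, hFdef]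
        ring_nf
    _ = K * 𝒩.card * (n * Real.exp (F * Real.log n)) := by ring
    _ = K * 𝒩.card * (n : ℝ) ^ (- -(1 + F)) := by rw [nat_mul_exp_mul_log hn0, neg_neg]

theorem InRegion.exists_measureReal_compl_forall_le_blockNuclear_own_le_rpow
    (h : InRegion K α β) (hK : K ≠ 0) (hd : d ≠ 0) (hβ : 0 < β) :
    ∃ η : ℝ, 0 < η ∧ ∀ n : ℕ, n ≠ 0 → ∀ p q : unitInterval, (p : ℝ) = α * Real.log n / n →
      ∀ (C : Fin n → Fin K) (R : Fin n → G.grp d), IsClustering C →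
        (sgbmMeasure C p q d G).real {ω | ∀ i, Real.sqrt (2 * K * β) / α * (n / K) * p ≤
          blockNuclear (observation C R ω * groundTruth C R) i (C i)}ᶜ ≤ (n : ℝ) ^ (-η) := by
  have hK0 : (0 : ℝ) < K := Nat.cast_pos.mpr (Nat.pos_of_ne_zero hK)
  have hs := sqrt_two_mul_mul_pos hK hβ
  have hlt := h.lt_sub_sub_mul_log hK hβ
  set s := Real.sqrt (2 * K * β)
  have hα : 0 < α := hs.trans h.1
  set F := (α - s - s * Real.log (α / s)) / K with hFdef
  have hF : 1 < F := (one_lt_div hK0).mpr hlt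
  refine ⟨F - 1, sub_pos.mpr hF, fun n hn p q hp C R hC => ?_⟩
  have hmp : (n : ℝ) / K * p = α / K * Real.log n := hp ▸ div_mul_mul_log_div hn K α
  have hexp : (n : ℝ) / K * p * (1 - s / α + s / α * Real.log (s / α)) = F * Real.log n := by
    rw [hmp, ← inv_div α s, Real.log_inv, hFdef]
    field_simp
    ring
  rw [mul_assoc]
  calc _ ≤ n * Real.exp (-F * Real.log n) := by
        refine measureReal_compl_forall_le_blockNuclear_own_le R p q hd fun i => ?_
        rw [neg_mul, ← hexp]
        exact measureReal_ownDegree_le_le_exp p q hC i (div_pos hs hα)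
          ((div_le_one hα).mpr h.1.le)
    _ = (n : ℝ) ^ (-(F - 1)) := by
        rw [nat_mul_exp_mul_log hn]
        ring_nf

end LogarithmicDegrees

theorem theorem2 (K d : ℕ) (hK : 1 ≤ K) (hd : 1 ≤ d) (G : SyncGroup)
    (hG : G = SyncGroup.special → 2 ≤ d) :
    (∀ α β : ℝ, 0 < α → 0 < β → InRegion K α β →
      ∃ χ : ℝ, 0 < χ ∧ ∃ c : ℝ, 0 < c ∧ ∃ N : ℕ, ∀ n : ℕ, N ≤ n →
        ∀ p q : unitInterval,
          (p : ℝ) = α * Real.log n / n → (q : ℝ) = β * Real.log n / n →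
        ∀ (C : Fin n → Fin K) (R : Fin n → G.grp d), IsClustering C →
          1 - (n : ℝ) ^ (-c) ≤
            (sgbmMeasure C p q d G).real
              {ω | PreservesBySeparation (observation C R ω) C (groundTruth C R)
                    (χ * ((n : ℝ) / K) * p) ∧
                  ∀ i : Fin n,
                    Real.sqrt (2 * K * β) / α * ((n : ℝ) / K) * p ≤
                      blockNuclear (observation C R ω * groundTruth C R) i (C i)}) ∧
    (∃ α β : ℝ, 0 < α ∧ 0 < β ∧ InRegion K α β ∧
      Real.sqrt α - Real.sqrt β < Real.sqrt K) := by
  have hK0 : K ≠ 0 := Nat.one_le_iff_ne_zero.mp hK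
  have hd0 : d ≠ 0 := Nat.one_le_iff_ne_zero.mp hd
  refine ⟨fun α β _ hβ hreg => ?_, exists_inRegion_sqrt_sub_sqrt_lt hK0⟩
  obtain ⟨χ, η₁, M, hχ, hη₁, hM, hsep⟩ := exists_measureReal_compl_preservesBySeparation_le_rpow
    hK0 hd0 hG hβ (hreg.one_add_sqrt_lt hK0 hβ)
  obtain ⟨η₂, hη₂, hown⟩ :=
    hreg.exists_measureReal_compl_forall_le_blockNuclear_own_le_rpow (G := G) hK0 hd0 hβ
  obtain ⟨c, hc, hsum⟩ := exists_pos_eventually_mul_rpow_neg_add_le hM hη₁ hη₂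
  obtain ⟨N, hN⟩ := Filter.eventually_atTop.mp
    ((tendsto_natCast_atTop_atTop.eventually hsum).and (Filter.eventually_ge_atTop 2))
  refine ⟨χ, hχ, c, hc, N, fun n hn p q hp hq C R hC => ?_⟩
  obtain ⟨hle, hn2⟩ := hN n hn
  exact (sub_le_sub_left hle 1).trans <| one_sub_add_le_measureReal_inter_of_compl_le
    (hsep n hn2 p q hp hq C R hC) (hown n (by lia) p q hp C R hC)
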